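/- Identify the group of characters of $\mathbb{Z}^d$ with the torus $(\mathbb{R}/\mathbb{Z})^d$, the point $\theta$ corresponding to the character $\chi_\theta(x)=e^{2\pi i(\theta_1x_1+\cdots+\theta_dx_d)}$. For a finite set $A\subset\mathbb{Z}^d$, a set $L\subset(\mathbb{R}/\mathbb{Z})^d$ is called a spectrum of $A$ if the restrictions to $A$ of the characters $\chi_\theta$, $\theta\in L$, form an orthogonal basis of $L^2(A)=\mathbb{C}^A$ (with respect to counting measure), and $A$ is called spectral if it has a spectrum. Let $A\subset\mathbb{Z}^d$ be a spectral set with $|A|\le 5$. Then $A$ admits a rational spectrum, that is, a spectrum $L\subset(\mathbb{Q}/\mathbb{Z})^d$. -/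

import Mathlib

open scoped InnerProductSpace

noncomputable section

/-- The restriction of a character `χ` of the discrete Abelian group `G` to the finite set `A`,
as an element of `L²(A)`. Haar measure on `G` is counting measure, so `L²(A)` is `ℂ^A` with the
inner product `⟪f, g⟫ = ∑ a ∈ A, conj (f a) * g a`. -/
def charRestrict {G : Type*} [AddCommGroup G] (A : Finset G) (χ : AddChar G Circle) :
    EuclideanSpace ℂ A :=
  WithLp.toLp 2 fun a : A => (χ (a : G) : ℂ)

/-- `Λ` is a spectrum of the finite set `A` in the discrete Abelian group `G`: the characters in
`Λ` form an orthogonal basis of `L²(A)`. (On a discrete group every character is continuous, and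
`L²(A)` is finite dimensional, so that completeness means spanning.) -/
structure IsSpectrum {G : Type*} [AddCommGroup G] (Λ : Set (AddChar G Circle)) (A : Finset G) :
    Prop where
  orthogonal : Λ.Pairwise fun χ ψ => ⟪charRestrict A χ, charRestrict A ψ⟫_ℂ = 0
  ne_zero : ∀ χ ∈ Λ, charRestrict A χ ≠ 0
  span_eq_top : Submodule.span ℂ (charRestrict A '' Λ) = ⊤

/-- A finite set is spectral if it has a spectrum. -/
def IsSpectral {G : Type*} [AddCommGroup G] (A : Finset G) : Prop :=
  ∃ Λ : Set (AddChar G Circle), IsSpectrum Λ A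

/-- The character `x ↦ exp (2πi (θ₁ x₁ + ⋯ + θ_d x_d))` of `ℤ^d` given by a point `θ` of the
torus `(ℝ/ℤ)^d`. -/
def torusChar {d : ℕ} (θ : Fin d → UnitAddCircle) : AddChar (Fin d → ℤ) Circle where
  toFun x := AddCircle.toCircle (∑ i, x i • θ i)
  map_zero_eq_one' := by simp
  map_add_eq_mul' x y := by
    simp [add_smul, Finset.sum_add_distrib, AddCircle.toCircle_add]

/-- The point `θ` of the torus `(ℝ/ℤ)^d` lies in `(ℚ/ℤ)^d`. -/
def IsRationalPoint {d : ℕ} (θ : Fin d → UnitAddCircle) : Prop :=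
  ∀ i, ∃ q : ℚ, θ i = ((q : ℝ) : UnitAddCircle)

end

/-! Since `ℚ` is a direct summand of the rational vector space `ℝ`, there is an additive retraction
`F` of `ℝ/ℤ` onto `ℚ/ℤ`. Apply `F` to every coordinate of every point of a spectrum. Orthogonality
says that certain sums of `|A|` points of the circle vanish, and it has to survive `F`. It does
whenever the ratios of the terms are roots of unity, because `F` fixes torsion. For at most four
terms, this always holds after splitting the sum into vanishing subsums
(`sum_toCircle_map_eq_zero_of_card_le_four`). Five terms leave too much freedom, so the whole matrix
of character values is used: it is a complex Hadamard matrix of order 5, whose cross ratios are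
fifth roots of unity (`IsComplexHadamard.crossRatio_pow_five`). For that theorem, nonnegativity of
the squared modulus of a `3 × 3` permanent separates the five entrywise ratios of two rows
(`IsComplexHadamard.separated`), so they nearly form a regular pentagon. Rounding the cross ratios
gives, up to relabelling, the multiplication table of `ZMod 5`, so the matrix is close to the
Fourier matrix. A quadratic error estimate (`norm_sub_stdAddChar_le_sq`) then forces the distance to
be zero. -/

open ComplexConjugate

local notation "𝐞" => (ZMod.stdAddChar : AddChar (ZMod 5) ℂ)

/-! ### Separation of cross ratios from 1 by a permanent identity -/

/-- The squared modulus of the permanent of a `3 × 3` matrix with unimodular entries, in terms of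
the inner products of its rows. -/
lemma permanent_mul_conj_of_unimodular (r s t : Fin 3 → ℂ) (hr : ∀ i, r i * conj (r i) = 1)
    (hs : ∀ i, s i * conj (s i) = 1) (ht : ∀ i, t i * conj (t i) = 1) :
    let α := r 0 * conj (s 0) + r 1 * conj (s 1) + r 2 * conj (s 2)
    let β := s 0 * conj (t 0) + s 1 * conj (t 1) + s 2 * conj (t 2)
    let γ := t 0 * conj (r 0) + t 1 * conj (r 1) + t 2 * conj (r 2)
    let P := r 0 * s 1 * t 2 + r 0 * s 2 * t 1 + r 1 * s 0 * t 2 + r 1 * s 2 * t 0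
      + r 2 * s 0 * t 1 + r 2 * s 1 * t 0
    P * conj P = 9 + α * β * γ + conj (α * β * γ)
      - (α * conj α + β * conj β + γ * conj γ) := by
  intro α β γ P
  have inv : ∀ z : ℂ, z * conj z = 1 → z ≠ 0 ∧ conj z = z⁻¹ := fun z hz =>
    ⟨left_ne_zero_of_mul_eq_one hz, eq_inv_of_mul_eq_one_right hz⟩
  obtain ⟨r0, er0⟩ := inv _ (hr 0)
  obtain ⟨r1, er1⟩ := inv _ (hr 1)
  obtain ⟨r2, er2⟩ := inv _ (hr 2)
  obtain ⟨s0, es0⟩ := inv _ (hs 0)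
  obtain ⟨s1, es1⟩ := inv _ (hs 1)
  obtain ⟨s2, es2⟩ := inv _ (hs 2)
  obtain ⟨t0, et0⟩ := inv _ (ht 0)
  obtain ⟨t1, et1⟩ := inv _ (ht 1)
  obtain ⟨t2, et2⟩ := inv _ (ht 2)
  simp only [α, β, γ, P, map_add, map_mul, map_inv₀, inv_inv, er0, er1, er2, es0, es1, es2,
    et0, et1, et2]
  field_simp
  ring

/-- For two columns of three unimodular rows, the product of the three inner products is
determined by their squared moduli. -/
lemma inner_mul_inner_mul_inner_of_two_columns (r s t : Fin 2 → ℂ)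
    (hr : ∀ i, r i * conj (r i) = 1) (hs : ∀ i, s i * conj (s i) = 1)
    (ht : ∀ i, t i * conj (t i) = 1) :
    let α := r 0 * conj (s 0) + r 1 * conj (s 1)
    let β := s 0 * conj (t 0) + s 1 * conj (t 1)
    let γ := t 0 * conj (r 0) + t 1 * conj (r 1)
    let y := r 1 * conj (r 0) + s 1 * conj (s 0) + t 1 * conj (t 0)
    α * β * γ = α * conj α + β * conj β + γ * conj γ - 4 ∧
      α * conj α + β * conj β + γ * conj γ = 3 + y * conj y := by
  intro α β γ y
  have inv : ∀ z : ℂ, z * conj z = 1 → z ≠ 0 ∧ conj z = z⁻¹ := fun z hz =>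
    ⟨left_ne_zero_of_mul_eq_one hz, eq_inv_of_mul_eq_one_right hz⟩
  obtain ⟨r0, er0⟩ := inv _ (hr 0)
  obtain ⟨r1, er1⟩ := inv _ (hr 1)
  obtain ⟨s0, es0⟩ := inv _ (hs 0)
  obtain ⟨s1, es1⟩ := inv _ (hs 1)
  obtain ⟨t0, et0⟩ := inv _ (ht 0)
  obtain ⟨t1, et1⟩ := inv _ (ht 1)
  simp only [α, β, γ, y, map_add, map_mul, map_inv₀, inv_inv, er0, er1, es0, es1, et0, et1]
  constructor <;>
  · field_simp
    ring

/-- A complex Hadamard matrix: unimodular entries, orthogonal rows and orthogonal columns. -/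
structure IsComplexHadamard {I J : Type*} [Fintype I] [Fintype J] (H : I → J → ℂ) : Prop where
  unimodular : ∀ r i, H r i * conj (H r i) = 1
  row : ∀ r s, r ≠ s → ∑ i, H r i * conj (H s i) = 0
  col : ∀ i j, i ≠ j → ∑ r, H r i * conj (H r j) = 0

lemma IsComplexHadamard.reindex {I J I' J' : Type*} [Fintype I] [Fintype J] [Fintype I']
    [Fintype J'] {H : I → J → ℂ} (h : IsComplexHadamard H) (e : I' ≃ I) (f : J' ≃ J) :
    IsComplexHadamard fun r i => H (e r) (f i) where
  unimodular r i := h.unimodular _ _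
  row r s hrs := by
    rw [f.sum_comp fun i => H (e r) i * conj (H (e s) i)]
    exact h.row _ _ (e.injective.ne hrs)
  col i j hij := by
    rw [e.sum_comp fun r => H r (f i) * conj (H r (f j))]
    exact h.col _ _ (f.injective.ne hij)

lemma IsComplexHadamard.norm_eq_one {I J : Type*} [Fintype I] [Fintype J] {H : I → J → ℂ}
    (h : IsComplexHadamard H) (r : I) (i : J) : ‖H r i‖ = 1 := by
  have := h.unimodular r i
  rw [Complex.mul_conj'] at this
  have h2 : ‖H r i‖ ^ 2 = 1 := by exact_mod_cast this
  exact (pow_eq_one_iff_of_nonneg (norm_nonneg _) two_ne_zero).1 h2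

/-- Let `P` be the permanent of the block of rows and columns 0, 1, 2. Row orthogonality replaces
its inner products by minus those `α, β, γ` of columns 3, 4, so `|P|² = 17 - 3S` with `S = |α|² +
|β|² + |γ|²`. Orthogonality of these two columns gives `S = 3 + |p + q|²`, where `p, q` are the two
products in the statement. Hence `0 ≤ |P|² = 3|p - q|² - 4`. -/
lemma IsComplexHadamard.separated_last {H : Fin 5 → Fin 5 → ℂ} (h : IsComplexHadamard H) :
    4 / 3 ≤ ‖H 3 4 * conj (H 3 3) - H 4 4 * conj (H 4 3)‖ ^ 2 := by
  have hA := permanent_mul_conj_of_unimodular ![H 0 0, H 0 1, H 0 2] ![H 1 0, H 1 1, H 1 2]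
    ![H 2 0, H 2 1, H 2 2] (by intro i; fin_cases i <;> exact h.unimodular _ _)
    (by intro i; fin_cases i <;> exact h.unimodular _ _)
    (by intro i; fin_cases i <;> exact h.unimodular _ _)
  have hB := inner_mul_inner_mul_inner_of_two_columns ![H 0 3, H 0 4] ![H 1 3, H 1 4]
    ![H 2 3, H 2 4] (by intro i; fin_cases i <;> exact h.unimodular _ _)
    (by intro i; fin_cases i <;> exact h.unimodular _ _)
    (by intro i; fin_cases i <;> exact h.unimodular _ _)
  have h01 := h.row 0 1 (by decide)
  have h12 := h.row 1 2 (by decide)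
  have h20 := h.row 2 0 (by decide)
  have hc := h.col 4 3 (by decide)
  have u3 := h.unimodular 3 3
  have u4 := h.unimodular 4 3
  have v3 := h.unimodular 3 4
  have v4 := h.unimodular 4 4
  simp only [Fin.sum_univ_five] at h01 h12 h20 hc
  simp only [Matrix.cons_val] at hA hB
  obtain ⟨hB1, hB2⟩ := hB
  generalize H 0 0 * H 1 1 * H 2 2 + H 0 0 * H 1 2 * H 2 1 + H 0 1 * H 1 0 * H 2 2
    + H 0 1 * H 1 2 * H 2 0 + H 0 2 * H 1 0 * H 2 1 + H 0 2 * H 1 1 * H 2 0 = P at hA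
  rw [show H 0 0 * conj (H 1 0) + H 0 1 * conj (H 1 1) + H 0 2 * conj (H 1 2)
      = -(H 0 3 * conj (H 1 3) + H 0 4 * conj (H 1 4)) by linear_combination h01,
    show H 1 0 * conj (H 2 0) + H 1 1 * conj (H 2 1) + H 1 2 * conj (H 2 2)
      = -(H 1 3 * conj (H 2 3) + H 1 4 * conj (H 2 4)) by linear_combination h12,
    show H 2 0 * conj (H 0 0) + H 2 1 * conj (H 0 1) + H 2 2 * conj (H 0 2)
      = -(H 2 3 * conj (H 0 3) + H 2 4 * conj (H 0 4)) by linear_combination h20] at hA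
  rw [show H 0 4 * conj (H 0 3) + H 1 4 * conj (H 1 3) + H 2 4 * conj (H 2 3)
      = -(H 3 4 * conj (H 3 3) + H 4 4 * conj (H 4 3)) by linear_combination hc] at hB2
  generalize H 0 3 * conj (H 1 3) + H 0 4 * conj (H 1 4) = α at *
  generalize H 1 3 * conj (H 2 3) + H 1 4 * conj (H 2 4) = β at *
  generalize H 2 3 * conj (H 0 3) + H 2 4 * conj (H 0 4) = γ at *
  have hy3 : (H 3 4 * conj (H 3 3)) * conj (H 3 4 * conj (H 3 3)) = 1 := by
    simp only [map_mul, Complex.conj_conj]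
    linear_combination v3 * (H 3 3 * conj (H 3 3)) + u3
  have hy4 : (H 4 4 * conj (H 4 3)) * conj (H 4 4 * conj (H 4 3)) = 1 := by
    simp only [map_mul, Complex.conj_conj]
    linear_combination v4 * (H 4 3 * conj (H 4 3)) + u4
  generalize H 3 4 * conj (H 3 3) = p at *
  generalize H 4 4 * conj (H 4 3) = q at *
  have hB1c := congrArg conj hB1
  simp only [map_add, map_mul, map_neg, map_sub, Complex.conj_conj, map_ofNat] at *
  have key : P * conj P = 3 * ((p - q) * conj (p - q)) - 4 := by
    simp only [map_sub]
    linear_combination hA - hB1 - hB1c - 3 * hB2 - 6 * hy3 - 6 * hy4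
  rw [Complex.mul_conj', Complex.mul_conj'] at key
  have key' : ‖P‖ ^ 2 = 3 * ‖p - q‖ ^ 2 - 4 := by exact_mod_cast key
  nlinarith [sq_nonneg ‖P‖]

/-- In a complex Hadamard matrix of order `5` the cross ratios of the entries stay away
from `1`. -/
lemma IsComplexHadamard.separated {I J : Type*} [Fintype I] [Fintype J] {H : I → J → ℂ}
    (h : IsComplexHadamard H) (hI : Fintype.card I = 5) (hJ : Fintype.card J = 5)
    {p q : I} {i j : J} (hpq : p ≠ q) (hij : i ≠ j) :
    4 / 3 ≤ ‖H p i * conj (H p j) - H q i * conj (H q j)‖ ^ 2 := by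
  have perm : ∀ a b : Fin 5, a ≠ b → ∃ σ : Equiv.Perm (Fin 5), σ 3 = a ∧ σ 4 = b := by
    intro a b hab
    refine ⟨(Equiv.swap 3 a).trans (Equiv.swap ((Equiv.swap 3 a) 4) b), ?_, ?_⟩
    · revert a b; decide
    · simp
  let e := Fintype.equivFinOfCardEq hI
  let f := Fintype.equivFinOfCardEq hJ
  obtain ⟨σ, hσ3, hσ4⟩ := perm (e p) (e q) (e.injective.ne hpq)
  obtain ⟨τ, hτ3, hτ4⟩ := perm (f j) (f i) (f.injective.ne hij.symm)
  have := (h.reindex (σ.trans e.symm) (τ.trans f.symm)).separated_last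
  simpa only [Equiv.trans_apply, hσ3, hσ4, hτ3, hτ4, Equiv.symm_apply_apply] using this

/-! ### Five separated points on the circle -/

/-- Finitely many `g`-separated reals in `[lo, x - g]` number at most `(x - lo) / g`. -/
lemma add_mul_card_le_of_separated {ι : Type*} [DecidableEq ι] (t : ι → ℝ) (g lo : ℝ)
    (s : Finset ι) :
    ∀ x, lo ≤ x → (∀ a ∈ s, lo ≤ t a) → (∀ a ∈ s, ∀ b ∈ s, a ≠ b → g ≤ |t a - t b|) →
      (∀ a ∈ s, t a + g ≤ x) → lo + g * s.card ≤ x := by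
  induction s using Finset.induction_on_max_value t with
  | empty => intro x hx _ _ _; simpa using hx
  | insert a s ha hmax ih =>
    intro x _ hlo hsep hx
    have h1 := ih (t a) (hlo a (Finset.mem_insert_self _ _))
      (fun b hb => hlo b (Finset.mem_insert_of_mem hb))
      (fun b hb c hc => hsep b (Finset.mem_insert_of_mem hb) c (Finset.mem_insert_of_mem hc))
      (fun b hb => by
        have h2 := hsep a (Finset.mem_insert_self _ _) b (Finset.mem_insert_of_mem hb)
          (by rintro rfl; exact ha hb)
        rw [abs_of_nonneg (by linarith [hmax b hb])] at h2
        linarith)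
    have h3 := hx a (Finset.mem_insert_self _ _)
    rw [Finset.card_insert_of_notMem ha]
    push_cast
    linarith

/-- Squared distance at least `4/3` means that the cosine of the angle is at most `1/3`; thus the
angle falls short of `2π/5` by less than `3/100`. -/
lemma one_third_lt_cos : 1 / 3 < Real.cos (2 * Real.pi / 5 - 3 / 100) := by
  have h5 : √5 ^ 2 = 5 := Real.sq_sqrt (by norm_num)
  have h5' : (2.236 : ℝ) < √5 := Real.lt_sqrt_of_sq_lt (by norm_num)
  have h5'' : √5 < 2.237 := (Real.sqrt_lt' (by norm_num)).2 (by norm_num)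
  have hc : Real.cos (2 * Real.pi / 5) = (√5 - 1) / 4 := by
    rw [show 2 * Real.pi / 5 = 2 * (Real.pi / 5) by ring, Real.cos_two_mul, Real.cos_pi_div_five]
    nlinarith
  have hs : 0.95 ≤ Real.sin (2 * Real.pi / 5) := by
    have h0 : 0 ≤ Real.sin (2 * Real.pi / 5) :=
      Real.sin_nonneg_of_nonneg_of_le_pi (by positivity) (by linarith [Real.pi_pos])
    have h1 := Real.sin_sq_add_cos_sq (2 * Real.pi / 5)
    rw [hc] at h1
    by_contra! h
    nlinarith
  have h3 : 1 - (3 / 100 : ℝ) ^ 2 / 2 ≤ Real.cos (3 / 100) := Real.one_sub_sq_div_two_le_cos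
  have h4 : (3 / 100 : ℝ) - (3 / 100) ^ 3 / 6 < Real.sin (3 / 100) :=
    Real.sin_gt_sub_cube (by norm_num)
  rw [Real.cos_sub, hc]
  nlinarith

lemma norm_exp_mul_I_sub_exp_mul_I_sq (x y : ℝ) :
    ‖Complex.exp (x * Complex.I) - Complex.exp (y * Complex.I)‖ ^ 2
      = 2 - 2 * Real.cos (x - y) := by
  rw [Complex.exp_ofReal_mul_I, Complex.exp_ofReal_mul_I, ← Complex.normSq_eq_norm_sq,
    Complex.normSq_apply, Real.cos_sub]
  simp only [Complex.sub_re, Complex.sub_im,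
    Complex.add_re, Complex.add_im, Complex.mul_re, Complex.mul_im, Complex.ofReal_re,
    Complex.ofReal_im, Complex.I_re, Complex.I_im]
  linear_combination Real.sin_sq_add_cos_sq x + Real.sin_sq_add_cos_sq y

lemma norm_exp_mul_I_sub_exp_mul_I_le (x y : ℝ) :
    ‖Complex.exp (x * Complex.I) - Complex.exp (y * Complex.I)‖ ≤ |x - y| := by
  have h := norm_exp_mul_I_sub_exp_mul_I_sq x y
  have h1 := Real.one_sub_sq_div_two_le_cos (x := x - y)
  refine le_of_sq_le_sq ?_ (abs_nonneg _)
  rw [sq_abs]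
  linarith

lemma exists_exp_mul_I_eq {w : ℂ} (hw : ‖w‖ = 1) :
    ∃ t : ℝ, 0 ≤ t ∧ t < 2 * Real.pi ∧ w = Complex.exp (t * Complex.I) := by
  have h := Complex.norm_mul_exp_arg_mul_I w
  rw [hw, Complex.ofReal_one, one_mul] at h
  rcases le_or_gt 0 w.arg with h0 | h0
  · exact ⟨w.arg, h0, by linarith [Complex.arg_le_pi w, Real.pi_pos], h.symm⟩
  · refine ⟨w.arg + 2 * Real.pi, by linarith [Complex.neg_pi_lt_arg w, Real.pi_pos],
      by linarith, ?_⟩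
    push_cast
    rw [add_mul, Complex.exp_periodic]
    exact h.symm

/-- If five points of the unit circle have pairwise squared distances at least `4 / 3`, then each
of their ratios is close to a fifth root of unity. -/
lemma exists_norm_sub_stdAddChar_le_of_separated {ι : Type*} [Fintype ι] [DecidableEq ι]
    (hι : Fintype.card ι = 5) {z : ι → ℂ} (hz : ∀ i, ‖z i‖ = 1)
    (hsep : ∀ i j, i ≠ j → 4 / 3 ≤ ‖z i - z j‖ ^ 2) (i j : ι) :
    ∃ k : ZMod 5, ‖z i * conj (z j) - ZMod.stdAddChar k‖ ≤ 12 / 100 := by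
  have hw : ∀ a, ‖z a * conj (z j)‖ = 1 := fun a => by simp [hz]
  choose t ht0 ht1 ht using fun a => exists_exp_mul_I_eq (hw a)
  set g : ℝ := 2 * Real.pi / 5 - 3 / 100 with hg
  have hpi := Real.pi_gt_three
  have hcos : ∀ a b, a ≠ b → Real.cos |t a - t b| ≤ 1 / 3 := by
    intro a b hab
    have h1 := norm_exp_mul_I_sub_exp_mul_I_sq (t a) (t b)
    rw [← ht, ← ht, ← sub_mul, norm_mul, RCLike.norm_conj, hz, mul_one] at h1
    rw [Real.cos_abs]
    linarith [hsep a b hab]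
  have hbig : ∀ x : ℝ, 0 ≤ x → Real.cos x ≤ 1 / 3 → g ≤ x := by
    intro x hx0 hx
    by_contra! hlt
    have := Real.cos_le_cos_of_nonneg_of_le_pi hx0 (by linarith : g ≤ Real.pi) hlt.le
    linarith [one_third_lt_cos]
  have hlo : ∀ a b, a ≠ b → g ≤ |t a - t b| := fun a b hab =>
    hbig _ (abs_nonneg _) (hcos a b hab)
  have hhi : ∀ a b, a ≠ b → |t a - t b| ≤ 2 * Real.pi - g := by
    intro a b hab
    have h1 : |t a - t b| ≤ 2 * Real.pi :=
      abs_le.2 ⟨by linarith [ht0 a, ht1 b], by linarith [ht0 b, ht1 a]⟩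
    have := hbig (2 * Real.pi - |t a - t b|) (by linarith)
      (by rw [Real.cos_two_pi_sub]; exact hcos a b hab)
    linarith
  have htj : t j = 0 := by
    have h1 := norm_exp_mul_I_sub_exp_mul_I_sq (t j) 0
    rw [← ht, Complex.mul_conj', hz] at h1
    simp only [Complex.ofReal_one, one_pow, Complex.ofReal_zero, zero_mul, Complex.exp_zero,
      sub_self, norm_zero, sub_zero] at h1
    have h2 : Real.cos (t j) = 1 := by nlinarith
    exact (Real.cos_eq_one_iff_of_lt_of_lt (by linarith [ht0 j]) (ht1 j)).1 h2
  -- This is the gap across the cut of the circle, between the last point and `t j = 0`.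
  have htop : ∀ a, t a ≤ 2 * Real.pi - g := by
    intro a
    by_cases h : a = j
    · rw [h, htj]; linarith
    · have := hhi a j h
      rwa [htj, sub_zero, abs_of_nonneg (ht0 a)] at this
  have hne : ∀ a b, t a < t b → t a + g ≤ t b := by
    intro a b hab
    have := hlo a b (by rintro rfl; exact lt_irrefl _ hab)
    rw [abs_of_neg (by linarith)] at this
    linarith
  have hless := add_mul_card_le_of_separated t g 0 {a | t a < t i} (t i) (ht0 i)
    (fun a _ => ht0 a) (fun a _ b _ => hlo a b)
    (fun a ha => hne a i (Finset.mem_filter.1 ha).2)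
  have hgreater := add_mul_card_le_of_separated (fun a => -t a) g (-(2 * Real.pi - g))
    {a | t i < t a} (-t i) (by linarith [htop i])
    (fun a _ => by linarith [htop a])
    (fun a _ b _ hab => by
      rw [show -t a - -t b = t b - t a by ring]; exact hlo b a hab.symm)
    (fun a ha => by linarith [hne i a (Finset.mem_filter.1 ha).2])
  have hcard : ((Finset.univ.filter fun a => t a < t i).card : ℝ)
      + (Finset.univ.filter fun a => t i < t a).card = 4 := by
    have h1 : (Finset.univ.filter fun a => t a < t i) ∪ (Finset.univ.filter fun a => t i < t a)
        = Finset.univ.erase i := by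
      ext a
      simp only [Finset.mem_union, Finset.mem_filter, Finset.mem_univ, true_and,
        Finset.mem_erase, and_true]
      constructor
      · rintro h rfl
        exact h.elim (lt_irrefl _) (lt_irrefl _)
      · intro h
        refine lt_or_gt_of_ne fun heq => ?_
        have := hlo a i h
        rw [heq, sub_self, abs_zero] at this
        linarith
    have h2 : Disjoint (Finset.univ.filter fun a => t a < t i)
        (Finset.univ.filter fun a => t i < t a) := by
      rw [Finset.disjoint_filter]
      intro a _ h
      exact h.not_gt
    have h3 := Finset.card_union_of_disjoint h2
    rw [h1, Finset.card_erase_of_mem (Finset.mem_univ _)] at h3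
    simp only [Finset.card_univ, hι] at h3
    exact_mod_cast h3.symm
  set k := (Finset.univ.filter fun a => t a < t i).card with hk
  have hk0 : (0 : ℝ) ≤ k := Nat.cast_nonneg _
  have hm0 : (0 : ℝ) ≤ (Finset.univ.filter fun a => t i < t a).card := Nat.cast_nonneg _
  rcases eq_or_ne i j with rfl | hij
  · exact ⟨0, by rw [Complex.mul_conj', hz]; norm_num⟩
  -- With `k` points below and `4 - k` above, `t i` lies between `k g` and `2π - (5 - k) g`. Since
  -- `1 ≤ k ≤ 4`, both bounds are within `4 · 3/100` of `2πk/5`.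
  have hk1 : (1 : ℝ) ≤ k := by
    have hti := hlo i j hij
    rw [htj, sub_zero, abs_of_nonneg (ht0 i)] at hti
    have hmem : j ∈ Finset.univ.filter fun a => t a < t i := by
      rw [Finset.mem_filter, htj]
      exact ⟨Finset.mem_univ _, by linarith⟩
    exact_mod_cast Finset.card_pos.2 ⟨j, hmem⟩
  refine ⟨((k : ℤ) : ZMod 5), ?_⟩
  rw [ZMod.stdAddChar_coe, ht i]
  have h1 := norm_exp_mul_I_sub_exp_mul_I_le (t i) (2 * Real.pi * k / 5)
  refine le_trans (le_of_eq ?_) (h1.trans (abs_le.2 ⟨?_, ?_⟩))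
  · congr 3
    push_cast
    ring
  · rw [hg] at hless
    nlinarith
  · rw [eq_sub_of_add_eq' hcard, hg] at hgreater
    nlinarith

/-! ### Isolation of the Fourier matrix of order 5 -/

lemma norm_stdAddChar (k : ZMod 5) : ‖𝐞 k‖ = 1 := by
  rw [ZMod.stdAddChar_apply, Circle.norm_coe]

lemma conj_stdAddChar (k : ZMod 5) : conj (𝐞 k) = 𝐞 (-k) := by
  rw [ZMod.stdAddChar_apply, ZMod.stdAddChar_apply, AddChar.map_neg_eq_inv, Circle.coe_inv_eq_conj]

lemma sum_stdAddChar_mul (b : ZMod 5) : ∑ k, 𝐞 (k * b) = if b = 0 then 5 else 0 := by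
  rw [AddChar.sum_mulShift b (ZMod.isPrimitive_stdAddChar 5)]
  simp

/-- A complex unimodular matrix whose deviation from the Fourier matrix of order `5` is at most
`δ` has deviation `O(δ ^ 2)` if its rows are orthogonal. -/
lemma norm_sub_stdAddChar_le_sq {G : ZMod 5 → ZMod 5 → ℂ} {δ : ℝ} (hG : ∀ r k, ‖G r k‖ = 1)
    (hrow : ∀ r s, r ≠ s → ∑ k, G r k * conj (G s k) = 0) (hG0 : ∀ k, G 0 k = 1)
    (h0G : ∀ r, G r 0 = 1) (hδ : ∀ r s k, ‖G r k * conj (G s k) - 𝐞 ((r - s) * k)‖ ≤ δ)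
    (r k : ZMod 5) : ‖G r k - 𝐞 (r * k)‖ ≤ 32 / 5 * δ ^ 2 := by
  have two_ne : (2 : ZMod 5) ≠ 0 := by decide
  have three_ne : (3 : ZMod 5) ≠ 0 := by decide
  have : Fact (Nat.Prime 5) := ⟨by norm_num⟩
  have hδ0 : 0 ≤ δ := (norm_nonneg _).trans (hδ 0 0 0)
  -- `u` is the relative error against the Fourier matrix and `U` its row-wise Fourier transform. To
  -- first order, orthogonality of rows `r, s` equates `U r` and `U s` at frequency `r - s`.
  set u : ZMod 5 → ZMod 5 → ℂ := fun r k => G r k * 𝐞 (-(r * k)) - 1 with hu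
  set U : ZMod 5 → ZMod 5 → ℂ := fun r m => ∑ k, 𝐞 (m * k) * u r k with hU
  have hee : ∀ a, 𝐞 a * 𝐞 (-a) = 1 := fun a => by
    rw [← AddChar.map_add_eq_mul, add_neg_cancel, AddChar.map_zero_eq_one]
  have huG : ∀ r k, G r k = 𝐞 (r * k) * (1 + u r k) := fun r k => by
    simp only [hu]
    linear_combination (-G r k) * hee (r * k)
  have hu_norm : ∀ r k, ‖G r k - 𝐞 (r * k)‖ = ‖u r k‖ := fun r k => by
    rw [huG, mul_add, mul_one, add_sub_cancel_left, norm_mul, norm_stdAddChar, one_mul]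
  have hu0 : ∀ r, u r 0 = 0 := fun r => by simp [hu, h0G]
  have h0u : ∀ k, u 0 k = 0 := fun k => by simp [hu, hG0]
  have hu_conj : ∀ s k, conj (u s k) = -u s k - conj (u s k) * u s k := fun s k => by
    have h1 : (1 + u s k) * conj (1 + u s k) = 1 := by
      have h2 : ‖1 + u s k‖ = 1 := by
        have := hG s k
        rwa [huG, norm_mul, norm_stdAddChar, one_mul] at this
      rw [Complex.mul_conj', h2]
      norm_num
    rw [map_add, map_one] at h1
    linear_combination h1
  have hprod : ∀ r s k, G r k * conj (G s k)
      = 𝐞 ((r - s) * k) * (1 + (u r k - u s k) - conj (u s k) * (u s k - u r k)) := by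
    intro r s k
    rw [huG r, huG s, map_mul (starRingEnd ℂ), conj_stdAddChar, map_add, map_one,
      show (r - s) * k = r * k + -(s * k) by ring, AddChar.map_add_eq_mul 𝐞 (r * k)]
    linear_combination 𝐞 (r * k) * 𝐞 (-(s * k)) * hu_conj s k
  have hdiff : ∀ r s k, ‖u s k - u r k‖ ≤ δ := by
    intro r s k
    have h1 : G r k * conj (G s k) - 𝐞 ((r - s) * k)
        = 𝐞 ((r - s) * k) * (conj (1 + u s k) * (u r k - u s k)) := by
      rw [hprod, map_add, map_one]
      ring
    have h2 : ‖1 + u s k‖ = 1 := by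
      have := hG s k
      rwa [huG, norm_mul, norm_stdAddChar, one_mul] at this
    have h3 := hδ r s k
    rw [h1, norm_mul, norm_mul, norm_stdAddChar, RCLike.norm_conj, h2, one_mul, one_mul,
      norm_sub_rev] at h3
    exact h3
  have hu_le : ∀ s k, ‖u s k‖ ≤ δ := fun s k => by
    have := hdiff 0 s k
    rwa [h0u, sub_zero] at this
  have hUeq : ∀ r s, r ≠ s → U r (r - s) - U s (r - s)
      = ∑ k, 𝐞 ((r - s) * k) * (conj (u s k) * (u s k - u r k)) := by
    intro r s hrs
    have h1 := hrow r s hrs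
    simp only [hprod, mul_sub, mul_add, mul_one, Finset.sum_sub_distrib,
      Finset.sum_add_distrib] at h1
    have h2 : ∑ k, 𝐞 ((r - s) * k) = 0 := by
      simp only [mul_comm (r - s)]
      rw [sum_stdAddChar_mul, if_neg (sub_ne_zero.2 hrs)]
    simp only [hU, mul_sub, Finset.sum_sub_distrib]
    linear_combination h1 - h2
  have hUle : ∀ r s, r ≠ s → ‖U r (r - s) - U s (r - s)‖ ≤ 4 * δ ^ 2 := by
    intro r s hrs
    rw [hUeq r s hrs, ← Finset.add_sum_erase _ _ (Finset.mem_univ (0 : ZMod 5)), hu0, map_zero,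
      zero_mul, mul_zero, zero_add]
    refine (norm_sum_le_of_le (f := fun k => 𝐞 ((r - s) * k) * (conj (u s k) * (u s k - u r k)))
      (n := fun _ => δ ^ 2) _ fun k _ => ?_).trans ?_
    · rw [norm_mul, norm_mul, norm_stdAddChar, one_mul, RCLike.norm_conj, sq]
      exact mul_le_mul (hu_le s k) (hdiff r s k) (norm_nonneg _) hδ0
    · rw [Finset.sum_const, Finset.card_erase_of_mem (Finset.mem_univ _), Finset.card_univ,
        ZMod.card]
      simp
  have hU0 : ∀ m, U 0 m = 0 := fun m => by simp [hU, h0u]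
  -- Fourier inversion, with frequency 0 eliminated by `u r 0 = 0`: the orthogonality relations say
  -- nothing about that frequency.
  have hinv : 5 * u r k = ∑ m, (𝐞 (-(m * k)) - 1) * U r m := by
    have h1 : ∀ l, ∑ m, 𝐞 (-(m * l)) * U r m = 5 * u r l := by
      intro l
      simp only [hU, Finset.mul_sum]
      rw [Finset.sum_comm]
      have h2 : ∀ n, ∑ m, 𝐞 (-(m * l)) * (𝐞 (m * n) * u r n)
          = (if n - l = 0 then 5 else 0) * u r n := by
        intro n
        rw [← sum_stdAddChar_mul, Finset.sum_mul]
        refine Finset.sum_congr rfl fun m _ => ?_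
        rw [← mul_assoc, ← AddChar.map_add_eq_mul]
        congr 2
        ring
      simp only [h2, sub_eq_zero, ite_mul, zero_mul]
      simp
    simp only [sub_mul, Finset.sum_sub_distrib, one_mul]
    have h3 := h1 0
    simp only [mul_zero, neg_zero, AddChar.map_zero_eq_one, one_mul, hu0] at h3
    rw [h1, h3, sub_zero]
  rcases eq_or_ne r 0 with rfl | hr
  · rw [hu_norm, h0u, norm_zero]
    positivity
  have h5 : (5 : ZMod 5) = 0 := rfl
  -- The nonzero frequencies of row `r` are its multiples `r, 2r, 3r, 4r = -r`. Comparisons with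
  -- rows `0` and `3r` bound them by `0, 8δ², 4δ², 4δ²`; the factors `𝐞 _ - 1` of norm at most 2
  -- make the total `32δ²`.
  have m1 : U r r = 0 := by
    have := hUeq r 0 hr
    simpa [hU0, h0u] using this
  have m4 : ‖U r (-r)‖ ≤ 4 * δ ^ 2 := by
    have := hUle 0 r hr.symm
    rwa [hU0, zero_sub, zero_sub, norm_neg] at this
  have m3 : ‖U r (3 * r)‖ ≤ 4 * δ ^ 2 := by
    have h1 := hUle r (3 * r) (fun h => by
      have : 2 * r = 0 := by linear_combination -h
      exact (mul_ne_zero two_ne hr) this)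
    have h2 : U (3 * r) (3 * r) = 0 := by
      have h3 : 3 * r ≠ 0 := mul_ne_zero three_ne hr
      have := hUeq (3 * r) 0 h3
      simpa [hU0, h0u] using this
    rwa [show r - 3 * r = 3 * r by linear_combination (-r) * h5, h2, sub_zero] at h1
  have m2 : ‖U r (2 * r)‖ ≤ 8 * δ ^ 2 := by
    have h1 := hUle (3 * r) r (fun h => by
      have : 2 * r = 0 := by linear_combination h
      exact (mul_ne_zero two_ne hr) this)
    have h2 := hUle 0 (3 * r) (mul_ne_zero three_ne hr).symm
    rw [hU0, zero_sub, norm_neg, show 0 - 3 * r = 2 * r by linear_combination (-r) * h5] at h2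
    rw [show 3 * r - r = 2 * r by ring, norm_sub_rev] at h1
    have := norm_le_norm_add_norm_sub' (U r (2 * r)) (U (3 * r) (2 * r))
    linarith
  have hsum : ‖(5 : ℂ) * u r k‖ ≤ 32 * δ ^ 2 := by
    have hfac : ∀ m, ‖(𝐞 (-(m * k)) - 1) * U r m‖ ≤ 2 * ‖U r m‖ := by
      intro m
      rw [norm_mul]
      refine mul_le_mul_of_nonneg_right ?_ (norm_nonneg _)
      refine (norm_sub_le _ _).trans ?_
      rw [norm_stdAddChar, norm_one]
      norm_num
    rw [hinv, ← Equiv.sum_comp (Equiv.mulRight₀ r hr)]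
    have h6 := Fin.sum_univ_five (fun j : ZMod 5 => (𝐞 (-(j * r * k)) - 1) * U r (j * r))
    refine (le_of_eq (congrArg norm h6)).trans ?_
    change ‖(𝐞 (-(0 * r * k)) - 1) * U r (0 * r) + (𝐞 (-(1 * r * k)) - 1) * U r (1 * r)
      + (𝐞 (-(2 * r * k)) - 1) * U r (2 * r) + (𝐞 (-(3 * r * k)) - 1) * U r (3 * r)
      + (𝐞 (-(4 * r * k)) - 1) * U r (4 * r)‖ ≤ _
    rw [zero_mul, zero_mul, neg_zero, AddChar.map_zero_eq_one, sub_self, zero_mul, zero_add,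
      one_mul, m1, mul_zero, zero_add]
    have h4 : (4 : ZMod 5) * r = -r := by linear_combination r * h5
    rw [h4]
    have f2 := hfac (2 * r)
    have f3 := hfac (3 * r)
    have f4 := hfac (-r)
    have := norm_add₃_le (a := (𝐞 (-(2 * r * k)) - 1) * U r (2 * r))
      (b := (𝐞 (-(3 * r * k)) - 1) * U r (3 * r)) (c := (𝐞 (-(-r * k)) - 1) * U r (-r))
    linarith
  rw [norm_mul, Complex.norm_ofNat] at hsum
  rw [hu_norm]
  linarith

/-- The Fourier matrix of order `5` is isolated among complex Hadamard matrices, with an explicit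
radius. -/
lemma IsComplexHadamard.crossRatio_eq_stdAddChar {H : ZMod 5 → ZMod 5 → ℂ}
    (h : IsComplexHadamard H)
    (hclose : ∀ r s k l, ‖H r k * conj (H s k) * conj (H r l * conj (H s l))
      - 𝐞 ((r - s) * (k - l))‖ ≤ 12 / 100) (r s k l : ZMod 5) :
    H r k * conj (H s k) * conj (H r l * conj (H s l)) = 𝐞 ((r - s) * (k - l)) := by
  obtain ⟨⟨r₀, s₀, k₀, l₀⟩, -, hmax⟩ := Finset.exists_max_image
    (Finset.univ : Finset (ZMod 5 × ZMod 5 × ZMod 5 × ZMod 5))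
    (fun q => ‖H q.1 q.2.2.1 * conj (H q.2.1 q.2.2.1)
      * conj (H q.1 q.2.2.2 * conj (H q.2.1 q.2.2.2))
      - 𝐞 ((q.1 - q.2.1) * (q.2.2.1 - q.2.2.2))‖) ⟨0, Finset.mem_univ _⟩
  set δ := ‖H r₀ k₀ * conj (H s₀ k₀) * conj (H r₀ l₀ * conj (H s₀ l₀))
      - 𝐞 ((r₀ - s₀) * (k₀ - l₀))‖ with hδ
  replace hmax : ∀ r s k l, ‖H r k * conj (H s k) * conj (H r l * conj (H s l))
      - 𝐞 ((r - s) * (k - l))‖ ≤ δ := fun r s k l => hmax (r, s, k, l) (Finset.mem_univ _)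
  have hsmall : δ ≤ 12 / 100 := hclose _ _ _ _
  have hδ0 : 0 ≤ δ := norm_nonneg _
  -- Dephasing at row `s₀` and column `l₀` turns the worst cross ratio into a single entry of `G`,
  -- so the quadratic bound applies to the maximum `δ` itself.
  set G : ZMod 5 → ZMod 5 → ℂ := fun r k => H (r + s₀) (k + l₀) * conj (H s₀ (k + l₀))
    * conj (H (r + s₀) l₀ * conj (H s₀ l₀)) with hG
  have hGG : ∀ r s k, G r k * conj (G s k) = H (r + s₀) (k + l₀) * conj (H (s + s₀) (k + l₀))
      * conj (H (r + s₀) l₀ * conj (H (s + s₀) l₀)) := by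
    intro r s k
    have h1 := h.unimodular s₀ (k + l₀)
    have h2 := h.unimodular s₀ l₀
    simp only [hG, map_mul, Complex.conj_conj]
    calc _ = H (r + s₀) (k + l₀) * conj (H (s + s₀) (k + l₀)) *
        (conj (H (r + s₀) l₀) * H (s + s₀) l₀) * (H s₀ (k + l₀) * conj (H s₀ (k + l₀)))
        * (H s₀ l₀ * conj (H s₀ l₀)) := by ring
      _ = _ := by rw [h1, h2, mul_one, mul_one]
  have key := norm_sub_stdAddChar_le_sq (G := G) (δ := δ)
    (fun r k => by simp [hG, h.norm_eq_one])
    (fun r s hrs => by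
      simp only [hGG, ← Finset.sum_mul]
      have h1 : ∑ k, H (r + s₀) (k + l₀) * conj (H (s + s₀) (k + l₀)) = 0 :=
        (h.reindex (Equiv.addRight s₀) (Equiv.addRight l₀)).row r s hrs
      rw [h1, zero_mul])
    (fun k => by
      simp only [hG, zero_add]
      rw [h.unimodular, h.unimodular, map_one, one_mul])
    (fun r => by
      simp only [hG, zero_add]
      rw [Complex.mul_conj']
      simp [h.norm_eq_one])
    (fun r s k => by
      rw [hGG]
      have := hmax (r + s₀) (s + s₀) (k + l₀) l₀
      rwa [add_sub_add_right_eq_sub, add_sub_cancel_right] at this)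
    (r₀ - s₀) (k₀ - l₀)
  have hδle : δ ≤ 32 / 5 * δ ^ 2 := by
    simp only [hG, sub_add_cancel] at key
    exact key
  -- A positive `δ` would be at least `5/32`, which exceeds `12/100`.
  have hδz : δ = 0 := by
    by_contra hne
    have : 0 < δ := lt_of_le_of_ne hδ0 (Ne.symm hne)
    nlinarith
  have := hmax r s k l
  rw [hδz] at this
  exact sub_eq_zero.1 (norm_le_zero_iff.1 this)

/-! ### Rounding to fifth roots of unity and the resulting combinatorics -/

/-- For a nontrivial fifth root of unity `z`, `w = 2 Re z` satisfies `w² + w = 1`; a distance below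
1 from 1 would give `w > 1`. -/
lemma eq_zero_of_norm_stdAddChar_sub_one_lt {a : ZMod 5} (h : ‖𝐞 a - 1‖ < 1) : a = 0 := by
  by_contra ha
  have hsum : 1 + 𝐞 a + 𝐞 a ^ 2 + 𝐞 a ^ 3 + 𝐞 a ^ 4 = 0 := by
    have h1 := sum_stdAddChar_mul a
    rw [if_neg ha] at h1
    have h2 := (Fin.sum_univ_five (fun k : ZMod 5 => 𝐞 (k * a))).symm.trans h1
    change 𝐞 (0 * a) + 𝐞 (1 * a) + 𝐞 (2 * a) + 𝐞 (3 * a) + 𝐞 (4 * a) = 0 at h2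
    have h3 : ∀ n : ℕ, 𝐞 ((n : ZMod 5) * a) = 𝐞 a ^ n := fun n => by
      rw [← nsmul_eq_mul, AddChar.map_nsmul_eq_pow]
    have e2 := h3 2
    have e3 := h3 3
    have e4 := h3 4
    simp only [Nat.cast_ofNat] at e2 e3 e4
    rw [e2, e3, e4, zero_mul, one_mul, AddChar.map_zero_eq_one] at h2
    exact h2
  have hn := norm_stdAddChar a
  generalize 𝐞 a = z at *
  have hz : z.re ^ 2 + z.im ^ 2 = 1 := by
    have := Complex.normSq_eq_norm_sq z
    rw [hn, Complex.normSq_apply] at this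
    linarith
  have hre : 1 / 2 < z.re := by
    have h1 : ‖z - 1‖ ^ 2 < 1 := by nlinarith [norm_nonneg (z - 1)]
    rw [← Complex.normSq_eq_norm_sq, Complex.normSq_apply] at h1
    simp only [Complex.sub_re, Complex.sub_im, Complex.one_re, Complex.one_im] at h1
    nlinarith
  have hzz : z * conj z = 1 := by
    rw [Complex.mul_conj', hn]
    norm_num
  have hz0 : z ≠ 0 := left_ne_zero_of_mul_eq_one hzz
  have hq : (z + conj z) ^ 2 + (z + conj z) - 1 = 0 := by
    rw [eq_inv_of_mul_eq_one_right hzz]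
    field_simp
    linear_combination hsum
  rw [Complex.add_conj] at hq
  have hq' : (2 * z.re) ^ 2 + 2 * z.re - 1 = 0 := by exact_mod_cast hq
  nlinarith

lemma stdAddChar_eq_of_norm_sub_lt {a b : ZMod 5} (h : ‖𝐞 a - 𝐞 b‖ < 1) : a = b := by
  refine sub_eq_zero.1 (eq_zero_of_norm_stdAddChar_sub_one_lt (lt_of_eq_of_lt ?_ h))
  have h1 : 𝐞 a = 𝐞 b * 𝐞 (a - b) := by
    rw [← AddChar.map_add_eq_mul, add_sub_cancel]
  rw [h1, ← mul_sub_one, norm_mul, norm_stdAddChar, one_mul]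

lemma norm_mul_sub_mul_le_of_norm_eq_one {a b c d : ℂ} (ha : ‖a‖ = 1) (hd : ‖d‖ = 1) :
    ‖a * b - c * d‖ ≤ ‖a - c‖ + ‖b - d‖ := by
  rw [show a * b - c * d = a * (b - d) + (a - c) * d by ring]
  refine (norm_add_le _ _).trans ?_
  rw [norm_mul, norm_mul, ha, hd]
  linarith

/-- Orthomorphisms of the cyclic group of order `5` fixing `0` are multiplications. -/
lemma eq_mul_of_injective_of_injective_sub {f : ZMod 5 → ZMod 5} (h0 : f 0 = 0)
    (hf : Function.Injective f) (hf' : Function.Injective fun x => f x - x) (x : ZMod 5) :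
    f x = f 1 * x := by
  have key : ∀ a b c d : ZMod 5, [0, a, b, c, d].Nodup →
      [0 - 0, a - 1, b - 2, c - 3, d - 4].Nodup → b = a * 2 ∧ c = a * 3 ∧ d = a * 4 := by
    decide
  have hnodup : ([0, 1, 2, 3, 4] : List (ZMod 5)).Nodup := by decide
  have h1 := hnodup.map hf
  have h1' := hnodup.map hf'
  simp only [List.map_cons, List.map_nil, h0] at h1 h1'
  obtain ⟨h2, h3, h4⟩ := key _ _ _ _ h1 h1'
  have hx : x = 0 ∨ x = 1 ∨ x = 2 ∨ x = 3 ∨ x = 4 := by revert x; decide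
  rcases hx with rfl | rfl | rfl | rfl | rfl
  · rw [h0, mul_zero]
  · rw [mul_one]
  · exact h2
  · exact h3
  · exact h4

/-- A nowhere degenerate "cross difference" on `ZMod 5 × ZMod 5` is, up to relabelling, that of
the multiplication table. -/
lemma exists_perm_of_crossDifference_ne_zero {κ : ZMod 5 → ZMod 5 → ZMod 5 → ZMod 5 → ZMod 5}
    (hrow : ∀ r s t i j, κ r s i j + κ s t i j = κ r t i j)
    (hcol : ∀ r s i j l, κ r s i j + κ r s j l = κ r s i l)
    (hne : ∀ r s i j, r ≠ s → i ≠ j → κ r s i j ≠ 0) :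
    ∃ c d : Equiv.Perm (ZMod 5), ∀ r s i j, κ r s i j = (c r - c s) * (d i - d j) := by
  have hrr : ∀ r i j, κ r r i j = 0 := fun r i j => by simpa using hrow r r r i j
  have hii : ∀ r s i, κ r s i i = 0 := fun r s i => by simpa using hcol r s i i i
  -- The cocycle relations reduce `κ` to its values based at row 0 and column 0.
  have hK : ∀ r s i j, κ r s i j = κ r 0 i 0 - κ r 0 j 0 - (κ s 0 i 0 - κ s 0 j 0) := by
    intro r s i j
    linear_combination hrow r s 0 i j + hcol r 0 i j 0 - hcol s 0 i j 0
  have hinj : ∀ r, r ≠ 0 → Function.Injective fun i => κ r 0 i 0 := by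
    intro r hr i j hij
    by_contra h
    apply hne r 0 i j hr h
    have hij' : κ r 0 i 0 = κ r 0 j 0 := hij
    rw [hK, hij', hrr, hrr]
    ring
  let d : Equiv.Perm (ZMod 5) :=
    Equiv.ofBijective _ (Finite.injective_iff_bijective.1 (hinj 1 (by decide)))
  have hd : ∀ i, d i = κ 1 0 i 0 := fun i => rfl
  have hd0 : d.symm 0 = 0 := by rw [Equiv.symm_apply_eq, hd, hii]
  have hmul : ∀ r i, κ r 0 i 0 = κ r 0 (d.symm 1) 0 * d i := by
    intro r i
    rcases eq_or_ne r 0 with rfl | hr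
    · rw [hrr, hrr, zero_mul]
    rcases eq_or_ne r 1 with rfl | hr1
    · rw [← hd, ← hd, Equiv.apply_symm_apply, one_mul]
    -- Row 1 serves as the coordinate `d`. In it, nondegeneracy against rows 0 and 1 makes row `r`
    -- an orthomorphism, hence linear; its slope is the label `c r`.
    have := eq_mul_of_injective_of_injective_sub (f := fun x => κ r 0 (d.symm x) 0)
      (by simp only [hd0, hii]) ((hinj r hr).comp d.symm.injective) (by
        intro x y hxy
        by_contra h
        apply hne r 1 (d.symm x) (d.symm y) hr1 (d.symm.injective.ne h)
        rw [hK, ← hd, ← hd, Equiv.apply_symm_apply, Equiv.apply_symm_apply]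
        linear_combination hxy) (d i)
    simpa only [Equiv.symm_apply_apply] using this
  have hc : Function.Injective fun r => κ r 0 (d.symm 1) 0 := by
    intro r s hrs
    by_contra h
    have h1 : d.symm 1 ≠ 0 := by
      rw [← hd0]
      exact d.symm.injective.ne (by decide)
    apply hne r s (d.symm 1) 0 h h1
    have hrs' : κ r 0 (d.symm 1) 0 = κ s 0 (d.symm 1) 0 := hrs
    rw [hK, hrs', hii, hii]
    ring
  refine ⟨Equiv.ofBijective _ (Finite.injective_iff_bijective.1 hc), d, fun r s i j => ?_⟩
  rw [hK, hmul r i, hmul r j, hmul s i, hmul s j]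
  simp only [Equiv.ofBijective_apply]
  ring

/-! ### Cross ratios of complex Hadamard matrices of order 5 -/

lemma IsComplexHadamard.transpose {I J : Type*} [Fintype I] [Fintype J] {H : I → J → ℂ}
    (h : IsComplexHadamard H) : IsComplexHadamard fun i r => H r i where
  unimodular i r := h.unimodular r i
  row i j hij := h.col i j hij
  col r s hrs := h.row r s hrs

/-- All cross ratios of entries of a complex Hadamard matrix indexed by `ZMod 5` are fifth roots of
unity. -/
lemma IsComplexHadamard.crossRatio_pow_five_of_zmod {H : ZMod 5 → ZMod 5 → ℂ}
    (h : IsComplexHadamard H) (r s i j : ZMod 5) :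
    (H r i * conj (H s i) * conj (H r j * conj (H s j))) ^ 5 = 1 := by
  set Γ : ZMod 5 → ZMod 5 → ZMod 5 → ZMod 5 → ℂ := fun r s i j =>
    H r i * conj (H s i) * conj (H r j * conj (H s j)) with hΓ
  have hΓ1 : ∀ r s i j, ‖Γ r s i j‖ = 1 := fun r s i j => by simp [hΓ, h.norm_eq_one]
  have hsep : ∀ r s i j : ZMod 5, r ≠ s → i ≠ j →
      4 / 3 ≤ ‖H r i * conj (H s i) - H r j * conj (H s j)‖ ^ 2 := fun r s i j hrs hij =>
    h.transpose.separated (ZMod.card 5) (ZMod.card 5) (p := i) (q := j) (i := r) (j := s) hij hrs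
  have hex : ∀ r s i j, ∃ k, ‖Γ r s i j - 𝐞 k‖ ≤ 12 / 100 := by
    intro r s i j
    rcases eq_or_ne r s with rfl | hrs
    · refine ⟨0, ?_⟩
      simp only [hΓ]
      rw [h.unimodular, h.unimodular]
      norm_num
    · exact exists_norm_sub_stdAddChar_le_of_separated (ZMod.card 5) (z := fun i => H r i * conj (H s i))
        (fun i => by simp [h.norm_eq_one]) (fun i j hij => hsep r s i j hrs hij) i j
  choose κ hκ using hex
  -- Three rounding errors total `36/100`, below the separation of distinct fifth roots of unity, so
  -- multiplicative relations become additive ones.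
  have hadd : ∀ x y z k l m, ‖x‖ = 1 → x * y = z → ‖x - 𝐞 k‖ ≤ 12 / 100 →
      ‖y - 𝐞 l‖ ≤ 12 / 100 → ‖z - 𝐞 m‖ ≤ 12 / 100 → k + l = m := by
    intro x y z k l m hx hxy h1 h2 h3
    apply stdAddChar_eq_of_norm_sub_lt
    have h4 := norm_mul_sub_mul_le_of_norm_eq_one (b := y) (c := 𝐞 k) hx (norm_stdAddChar l)
    rw [hxy, ← AddChar.map_add_eq_mul] at h4
    have h5 := norm_sub_le_norm_sub_add_norm_sub (𝐞 (k + l)) z (𝐞 m)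
    rw [norm_sub_rev (𝐞 (k + l)) z] at h5
    linarith
  obtain ⟨c, d, hcd⟩ := exists_perm_of_crossDifference_ne_zero (κ := κ)
    (fun r s t i j => hadd _ _ _ _ _ _ (hΓ1 r s i j) (by
      have h1 := h.unimodular s i
      have h2 := h.unimodular s j
      simp only [hΓ, map_mul, Complex.conj_conj]
      calc _ = H r i * conj (H t i) * (conj (H r j) * H t j) * (H s i * conj (H s i))
            * (H s j * conj (H s j)) := by ring
        _ = _ := by rw [h1, h2, mul_one, mul_one]) (hκ r s i j) (hκ s t i j) (hκ r t i j))
    (fun r s i j l => hadd _ _ _ _ _ _ (hΓ1 r s i j) (by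
      have h1 := h.unimodular r j
      have h2 := h.unimodular s j
      simp only [hΓ, map_mul, Complex.conj_conj]
      calc _ = H r i * conj (H s i) * (conj (H r l) * H s l) * (H r j * conj (H r j))
            * (H s j * conj (H s j)) := by ring
        _ = _ := by rw [h1, h2, mul_one, mul_one]) (hκ r s i j) (hκ r s j l) (hκ r s i l))
    (fun r s i j hrs hij h0 => by
      have h1 := hκ r s i j
      rw [h0, AddChar.map_zero_eq_one] at h1
      have h2 : ‖Γ r s i j - 1‖ = ‖H r i * conj (H s i) - H r j * conj (H s j)‖ := by
        have h3 : ‖H r j * conj (H s j)‖ = 1 := by simp [h.norm_eq_one]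
        have h4 : (H r j * conj (H s j)) * conj (H r j * conj (H s j)) = 1 := by
          rw [Complex.mul_conj', h3]
          norm_num
        rw [← h4, hΓ, ← sub_mul, norm_mul, RCLike.norm_conj, h3, mul_one]
      have h5 := hsep r s i j hrs hij
      rw [← h2] at h5
      nlinarith [norm_nonneg (Γ r s i j - 1)])
  have hfin := (h.reindex c.symm d.symm).crossRatio_eq_stdAddChar
    (fun r s k l => by
      have := hκ (c.symm r) (c.symm s) (d.symm k) (d.symm l)
      rw [hcd] at this
      simpa only [Equiv.apply_symm_apply] using this) (c r) (c s) (d i) (d j)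
  have hfin' : Γ r s i j = 𝐞 ((c r - c s) * (d i - d j)) := by
    simpa only [Equiv.symm_apply_apply] using hfin
  change Γ r s i j ^ 5 = 1
  rw [hfin', ← AddChar.map_nsmul_eq_pow, nsmul_eq_mul]
  have h5 : ((5 : ℕ) : ZMod 5) = 0 := rfl
  rw [h5, zero_mul, AddChar.map_zero_eq_one]

/-- Complex Hadamard matrices of order `5` are equivalent to the Fourier matrix: all cross ratios
of entries are fifth roots of unity. -/
theorem IsComplexHadamard.crossRatio_pow_five {I J : Type*} [Fintype I] [Fintype J]
    {H : I → J → ℂ} (h : IsComplexHadamard H) (hI : Fintype.card I = 5)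
    (hJ : Fintype.card J = 5) (r s : I) (i j : J) :
    (H r i * conj (H s i) * conj (H r j * conj (H s j))) ^ 5 = 1 := by
  let e : I ≃ ZMod 5 := Fintype.equivOfCardEq (by rw [hI, ZMod.card])
  let f : J ≃ ZMod 5 := Fintype.equivOfCardEq (by rw [hJ, ZMod.card])
  simpa only [Equiv.symm_apply_apply] using
    (h.reindex e.symm f.symm).crossRatio_pow_five_of_zmod (e r) (e s) (f i) (f j)

/-- A one-sided inverse of a square matrix is two-sided, so `M Mᴴ = N` yields `Mᴴ M = N`. -/
lemma IsComplexHadamard.of_row {I J : Type*} [Fintype I] [Fintype J] {H : I → J → ℂ}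
    (hcard : Fintype.card I = Fintype.card J) (hu : ∀ r i, H r i * conj (H r i) = 1)
    (hrow : ∀ r s, r ≠ s → ∑ i, H r i * conj (H s i) = 0) : IsComplexHadamard H where
  unimodular := hu
  row := hrow
  col i j hij := by
    classical
    have hN : (Fintype.card J : ℂ) ≠ 0 :=
      Nat.cast_ne_zero.2 (Fintype.card_pos_iff.2 ⟨i⟩).ne'
    let M : Matrix I J ℂ := Matrix.of H
    have h1 : M * ((Fintype.card J : ℂ)⁻¹ • M.conjTranspose) = 1 := by
      ext r s
      rw [Matrix.mul_smul, Matrix.smul_apply, Matrix.mul_apply]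
      simp only [M, Matrix.of_apply, Matrix.conjTranspose_apply, RCLike.star_def]
      rcases eq_or_ne r s with rfl | hrs
      · simp [hu, hN]
      · rw [hrow r s hrs, smul_zero, Matrix.one_apply_ne hrs]
    have h2 := (Matrix.mul_eq_one_comm_of_card_eq _ _ _ hcard).1 h1
    have h3 := congrFun (congrFun h2 j) i
    rw [Matrix.smul_mul, Matrix.smul_apply, Matrix.mul_apply, Matrix.one_apply_ne hij.symm,
      smul_eq_mul, mul_eq_zero, or_iff_right (inv_ne_zero hN)] at h3
    simp only [M, Matrix.of_apply, Matrix.conjTranspose_apply, RCLike.star_def] at h3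
    simpa only [mul_comm] using h3

/-! ### The retraction onto `ℚ/ℤ` and vanishing sums -/

/-- There is an endomorphism of `ℝ / ℤ` with values in `ℚ / ℤ` which fixes `ℚ / ℤ`. -/
lemma exists_rational_retraction : ∃ F : UnitAddCircle →+ UnitAddCircle,
    (∀ x, ∃ q : ℚ, F x = ((q : ℝ) : UnitAddCircle)) ∧
      ∀ (x : UnitAddCircle) (n : ℕ), n ≠ 0 → n • x = 0 → F x = x := by
  -- `f` is a `ℚ`-linear projection of `ℝ` onto `ℚ`; since `f 1 = 1`, it descends modulo `ℤ`.
  obtain ⟨f, hf⟩ := (Algebra.linearMap ℚ ℝ).exists_leftInverse_of_injective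
    (LinearMap.ker_eq_bot.2 (algebraMap ℚ ℝ).injective)
  have hf' : ∀ q : ℚ, f (q : ℝ) = q := fun q => LinearMap.congr_fun hf q
  let g : ℝ →+ ℝ := (Rat.castHom ℝ).toAddMonoidHom.comp f.toAddMonoidHom
  have hg : ∀ x, g x = ((f x : ℚ) : ℝ) := fun x => rfl
  let F : UnitAddCircle →+ UnitAddCircle :=
    QuotientAddGroup.map (AddSubgroup.zmultiples (1 : ℝ)) (AddSubgroup.zmultiples (1 : ℝ)) g (by
      rw [AddSubgroup.zmultiples_le, AddSubgroup.mem_comap, hg]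
      have h1 := hf' 1
      rw [Rat.cast_one] at h1
      rw [h1, Rat.cast_one]
      exact AddSubgroup.mem_zmultiples 1)
  have hF : ∀ x : ℝ, F (x : UnitAddCircle) = ((f x : ℚ) : ℝ) := fun x => rfl
  refine ⟨F, fun x => ?_, fun x n hn hx => ?_⟩
  · induction x using QuotientAddGroup.induction_on with
    | H x => exact ⟨f x, hF x⟩
  · induction x using QuotientAddGroup.induction_on with
    | H x =>
      have hx' : ((n • x : ℝ) : UnitAddCircle) = 0 := hx
      obtain ⟨m, hm⟩ := (AddCircle.coe_eq_zero_iff (1 : ℝ)).1 hx'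
      have hn' : (n : ℝ) ≠ 0 := Nat.cast_ne_zero.2 hn
      have hxq : x = ((m / n : ℚ) : ℝ) := by
        push_cast
        rw [eq_div_iff hn']
        simp only [zsmul_eq_mul, mul_one, nsmul_eq_mul] at hm
        linarith
      refine (hF x).trans ?_
      rw [hxq, hf']

section Vanishing

variable {F : UnitAddCircle →+ UnitAddCircle}

/-- `x - y` is torsion, so `F` fixes it: ratios that are roots of unity are preserved. -/
lemma toCircle_map_mul_toCircle_of_pow_eq
    (hF : ∀ (x : UnitAddCircle) (n : ℕ), n ≠ 0 → n • x = 0 → F x = x)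
    {x y : UnitAddCircle} {n : ℕ} (hn : n ≠ 0)
    (h : (x.toCircle : ℂ) ^ n = (y.toCircle : ℂ) ^ n) :
    ((F x).toCircle : ℂ) * y.toCircle = (F y).toCircle * x.toCircle := by
  have h1 : n • x = n • y := by
    apply AddCircle.injective_toCircle one_ne_zero
    rw [AddCircle.toCircle_nsmul, AddCircle.toCircle_nsmul]
    exact Subtype.coe_injective (by simpa only [Circle.coe_pow] using h)
  have h2 := hF (x - y) n hn (by rw [smul_sub, h1, sub_self])
  rw [map_sub, sub_eq_sub_iff_add_eq_add] at h2
  rw [← Circle.coe_mul, ← Circle.coe_mul, ← AddCircle.toCircle_add, ← AddCircle.toCircle_add, h2,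
    add_comm]

lemma sum_toCircle_map_eq_zero_of_pow_eq {ι : Type*} [Fintype ι]
    (hF : ∀ (x : UnitAddCircle) (n : ℕ), n ≠ 0 → n • x = 0 → F x = x)
    {t : ι → UnitAddCircle} {n : ℕ} (hn : n ≠ 0)
    (h : ∀ i j, ((t i).toCircle : ℂ) ^ n = ((t j).toCircle : ℂ) ^ n)
    (hsum : ∑ i, ((t i).toCircle : ℂ) = 0) : ∑ i, ((F (t i)).toCircle : ℂ) = 0 := by
  rcases isEmpty_or_nonempty ι with _ | ⟨⟨j⟩⟩
  · exact Finset.sum_of_isEmpty _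
  have h1 : (∑ i, ((F (t i)).toCircle : ℂ)) * (t j).toCircle = 0 := by
    rw [Finset.sum_mul, Finset.sum_congr rfl fun i _ =>
      toCircle_map_mul_toCircle_of_pow_eq hF hn (h i j), ← Finset.mul_sum, hsum, mul_zero]
  exact (mul_eq_zero.1 h1).resolve_right (Circle.coe_ne_zero _)

lemma toCircle_map_add_toCircle_map_eq_zero
    (hF : ∀ (x : UnitAddCircle) (n : ℕ), n ≠ 0 → n • x = 0 → F x = x)
    {x y : UnitAddCircle} (h : (x.toCircle : ℂ) + y.toCircle = 0) :
    ((F x).toCircle : ℂ) + (F y).toCircle = 0 := by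
  have h1 := toCircle_map_mul_toCircle_of_pow_eq hF (n := 2) (x := x) (y := y) two_ne_zero
    (by linear_combination ((x.toCircle : ℂ) - y.toCircle) * h)
  have h2 : (((F x).toCircle : ℂ) + (F y).toCircle) * y.toCircle = 0 := by
    linear_combination h1 + (F y).toCircle * h
  exact (mul_eq_zero.1 h2).resolve_right (Circle.coe_ne_zero _)

/-- Vanishing sums of at most four points of the circle are preserved by endomorphisms fixing the
roots of unity. -/
lemma sum_toCircle_map_eq_zero_of_card_le_four {ι : Type*} [Fintype ι]
    (hF : ∀ (x : UnitAddCircle) (n : ℕ), n ≠ 0 → n • x = 0 → F x = x)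
    (hι : Fintype.card ι ≤ 4) {t : ι → UnitAddCircle}
    (hsum : ∑ i, ((t i).toCircle : ℂ) = 0) : ∑ i, ((F (t i)).toCircle : ℂ) = 0 := by
  obtain ⟨n, hn⟩ : ∃ n, Fintype.card ι = n := ⟨_, rfl⟩
  let e := (Fintype.equivFinOfCardEq hn).symm
  rw [← Equiv.sum_comp e] at hsum ⊢
  -- Conjugates are inverses, so besides the sum `e₁` of the `n` points, `eₙ₋₁` vanishes too.
  have hconj := congrArg conj hsum
  rw [map_sum, map_zero] at hconj
  simp only [← Circle.coe_inv_eq_conj, Circle.coe_inv] at hconj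
  have hne : ∀ x : UnitAddCircle, (x.toCircle : ℂ) ≠ 0 := fun x => Circle.coe_ne_zero _
  rw [hn] at hι
  interval_cases n
  · exact Finset.sum_of_isEmpty _
  · rw [Fin.sum_univ_one] at hsum
    exact absurd hsum (hne _)
  · rw [Fin.sum_univ_two] at hsum ⊢
    exact toCircle_map_add_toCircle_map_eq_zero hF hsum
  · refine sum_toCircle_map_eq_zero_of_pow_eq hF (t := fun i => t (e i)) three_ne_zero ?_ hsum
    rw [Fin.sum_univ_three] at hsum hconj
    have h0 := hne (t (e 0))
    have h1 := hne (t (e 1))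
    have h2 := hne (t (e 2))
    field_simp at hconj
    -- With `e₁ = e₂ = 0` the three points are roots of `X³ - e₃`.
    have hpow : ∀ i, ((t (e i)).toCircle : ℂ) ^ 3 = (t (e 0)).toCircle * (t (e 1)).toCircle
        * (t (e 2)).toCircle := by
      generalize ha : ((t (e 0)).toCircle : ℂ) = a at *
      generalize hb : ((t (e 1)).toCircle : ℂ) = b at *
      generalize hc : ((t (e 2)).toCircle : ℂ) = c at *
      rw [Fin.forall_fin_succ, Fin.forall_fin_succ, Fin.forall_fin_one]
      change ((t (e 0)).toCircle : ℂ) ^ 3 = _ ∧ ((t (e 1)).toCircle : ℂ) ^ 3 = _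
        ∧ ((t (e 2)).toCircle : ℂ) ^ 3 = _
      rw [ha, hb, hc]
      refine ⟨?_, ?_, ?_⟩
      · linear_combination a ^ 2 * hsum - a * hconj
      · linear_combination b ^ 2 * hsum - b * hconj
      · linear_combination c ^ 2 * hsum - c * hconj
    exact fun i j => (hpow i).trans (hpow j).symm
  · rw [Fin.sum_univ_four] at hsum hconj ⊢
    have h0 := hne (t (e 0))
    have h1 := hne (t (e 1))
    have h2 := hne (t (e 2))
    have h3 := hne (t (e 3))
    -- The product equals `a² e₁ + e₃ = 0`, where `a` is the first point; so the four points split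
    -- into two antipodal pairs.
    have key : (((t (e 0)).toCircle : ℂ) + (t (e 1)).toCircle)
        * (((t (e 0)).toCircle : ℂ) + (t (e 2)).toCircle)
        * (((t (e 0)).toCircle : ℂ) + (t (e 3)).toCircle) = 0 := by
      field_simp at hconj
      linear_combination ((t (e 0)).toCircle : ℂ) ^ 2 * hsum + hconj
    rcases mul_eq_zero.1 key with hk | hk
    · rcases mul_eq_zero.1 hk with hk | hk
      · have := toCircle_map_add_toCircle_map_eq_zero hF hk
        have := toCircle_map_add_toCircle_map_eq_zero hF
          (x := t (e 2)) (y := t (e 3)) (by linear_combination hsum - hk)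
        linear_combination ‹((F (t (e 0))).toCircle : ℂ) + (F (t (e 1))).toCircle = 0›
          + this
      · have := toCircle_map_add_toCircle_map_eq_zero hF hk
        have := toCircle_map_add_toCircle_map_eq_zero hF
          (x := t (e 1)) (y := t (e 3)) (by linear_combination hsum - hk)
        linear_combination ‹((F (t (e 0))).toCircle : ℂ) + (F (t (e 2))).toCircle = 0›
          + this
    · have := toCircle_map_add_toCircle_map_eq_zero hF hk
      have := toCircle_map_add_toCircle_map_eq_zero hF
        (x := t (e 1)) (y := t (e 2)) (by linear_combination hsum - hk)
      linear_combination ‹((F (t (e 0))).toCircle : ℂ) + (F (t (e 3))).toCircle = 0›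
        + this

end Vanishing

/-! ### Spectra, torus characters and the conclusion -/

lemma inner_charRestrict {G : Type*} [AddCommGroup G] (A : Finset G) (χ ψ : AddChar G Circle) :
    ⟪charRestrict A χ, charRestrict A ψ⟫_ℂ = ∑ a : A, (ψ a : ℂ) * conj (χ a : ℂ) := by
  simp [charRestrict, PiLp.inner_apply]

lemma IsSpectrum.card_eq {G : Type*} [AddCommGroup G] {A : Finset G}
    {Λ : Set (AddChar G Circle)} (h : IsSpectrum Λ A) : Finite Λ ∧ Nat.card Λ = A.card := by
  have hli : LinearIndependent ℂ fun χ : Λ => charRestrict A χ.1 :=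
    linearIndependent_of_ne_zero_of_inner_eq_zero (fun χ => h.ne_zero _ χ.2)
      fun χ ψ hχψ => h.orthogonal χ.2 ψ.2 (Subtype.coe_injective.ne hχψ)
  have hfin : Finite Λ := hli.finite
  have := Fintype.ofFinite Λ
  refine ⟨hfin, ?_⟩
  let b := Module.Basis.mk hli (by
    rw [← h.span_eq_top, Set.image_eq_range])
  rw [Nat.card_eq_fintype_card, ← Module.finrank_eq_card_basis b, finrank_euclideanSpace,
    Fintype.card_coe]

/-- A family of `A.card` pairwise orthogonal characters is a spectrum of `A`. -/
lemma IsSpectrum.of_family {G : Type*} [AddCommGroup G] {A : Finset G} {ι : Type*} [Finite ι]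
    (hι : Nat.card ι = A.card) (v : ι → AddChar G Circle)
    (hv : Pairwise fun i j => ⟪charRestrict A (v i), charRestrict A (v j)⟫_ℂ = 0) :
    IsSpectrum (Set.range v) A := by
  have := Fintype.ofFinite ι
  have hne : ∀ i, charRestrict A (v i) ≠ 0 := by
    intro i h0
    have hpos : 0 < A.card := by
      rw [← hι]
      exact Nat.card_pos_iff.2 ⟨⟨i⟩, inferInstance⟩
    obtain ⟨a, ha⟩ := Finset.card_pos.1 hpos
    have h1 : charRestrict A (v i) ⟨a, ha⟩ = 0 := by rw [h0]; rfl
    exact Circle.coe_ne_zero _ h1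
  have hli := linearIndependent_of_ne_zero_of_inner_eq_zero hne hv
  refine ⟨?_, ?_, ?_⟩
  · rintro _ ⟨i, rfl⟩ _ ⟨j, rfl⟩ hij
    exact hv fun h => hij (congrArg v h)
  · rintro _ ⟨i, rfl⟩
    exact hne i
  · rw [← Set.range_comp]
    exact hli.span_eq_top_of_card_eq_finrank' (by
      rw [finrank_euclideanSpace, Fintype.card_coe, ← hι, Nat.card_eq_fintype_card])

lemma torusChar_surjective {d : ℕ} :
    Function.Surjective (torusChar : (Fin d → UnitAddCircle) → AddChar (Fin d → ℤ) Circle) := by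
  intro χ
  have hsurj : ∀ z : Circle, ∃ x : UnitAddCircle, x.toCircle = z := fun z =>
    ⟨(AddCircle.homeomorphCircle one_ne_zero).symm z, by
      rw [← AddCircle.homeomorphCircle_apply one_ne_zero, Homeomorph.apply_symm_apply]⟩
  choose θ hθ using fun i : Fin d => hsurj (χ (Pi.single i 1))
  refine ⟨θ, AddChar.toAddMonoidHomEquiv.injective ?_⟩
  ext i
  change ((torusChar θ (Pi.single i 1) : Circle) : ℂ) = (χ (Pi.single i 1) : Circle)
  rw [← hθ]
  change ((∑ j, (Pi.single i 1 : Fin d → ℤ) j • θ j).toCircle : ℂ) = _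
  simp [Pi.single_apply]

lemma torusChar_mul_conj {d : ℕ} (θ η : Fin d → UnitAddCircle) (x : Fin d → ℤ) :
    (torusChar θ x : ℂ) * conj (torusChar η x : ℂ)
      = ((∑ i, x i • (θ i - η i)).toCircle : ℂ) := by
  have h : ∀ ξ : Fin d → UnitAddCircle, torusChar ξ x = (∑ i, x i • ξ i).toCircle := fun _ => rfl
  rw [h, h, ← Circle.coe_inv_eq_conj, ← Circle.coe_mul, ← AddCircle.toCircle_neg,
    ← AddCircle.toCircle_add, ← sub_eq_add_neg, ← Finset.sum_sub_distrib]
  simp only [smul_sub]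

theorem proposition2p2 (d : ℕ) (A : Finset (Fin d → ℤ)) (hcard : A.card ≤ 5)
    (hA : IsSpectral A) :
    ∃ L : Set (Fin d → UnitAddCircle),
      (∀ θ ∈ L, IsRationalPoint θ) ∧ IsSpectrum (torusChar '' L) A := by
  obtain ⟨Λ, hΛ⟩ := hA
  obtain ⟨hfin, hΛcard⟩ := hΛ.card_eq
  have := Fintype.ofFinite Λ
  obtain ⟨F, hFrat, hF⟩ := exists_rational_retraction
  choose θ hθ using fun χ : Λ => torusChar_surjective χ.1
  have horth : ∀ χ ψ : Λ, χ ≠ ψ → ∑ a : A, (χ.1 a : ℂ) * conj (ψ.1 a : ℂ) = 0 := by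
    intro χ ψ hne
    rw [← inner_charRestrict]
    exact hΛ.orthogonal ψ.2 χ.2 (Subtype.coe_injective.ne hne.symm)
  -- Indexing by `Λ` avoids a separate proof that the new points are distinct: this follows from
  -- orthogonality in `IsSpectrum.of_family`.
  refine ⟨Set.range fun χ i => F (θ χ i), ?_, ?_⟩
  · rintro _ ⟨χ, rfl⟩ i
    exact hFrat _
  rw [← Set.range_comp]
  refine IsSpectrum.of_family hΛcard _ fun χ ψ hne => ?_
  have hsum := horth ψ χ hne.symm
  -- Additivity moves `F` outside the integer combinations, leaving the old orthogonality sum with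
  -- `F` applied to each angle.
  simp only [inner_charRestrict, Function.comp_apply, torusChar_mul_conj, ← map_sub, ← map_zsmul,
    ← map_sum]
  have hval : ∀ a : A, (ψ.1 a : ℂ) * conj (χ.1 a : ℂ)
      = ((∑ i, a.1 i • (θ ψ i - θ χ i)).toCircle : ℂ) := fun a => by
    rw [← hθ, ← hθ, torusChar_mul_conj]
  simp only [hval] at hsum
  rcases Nat.lt_or_eq_of_le hcard with hlt | heq
  · exact sum_toCircle_map_eq_zero_of_card_le_four hF
      (by rw [Fintype.card_coe]; omega) hsum
  · have hΛ5 : Fintype.card Λ = 5 := by rw [← Nat.card_eq_fintype_card, hΛcard, heq]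
    have hA5 : Fintype.card A = 5 := by rw [Fintype.card_coe, heq]
    have hH : IsComplexHadamard fun (χ : Λ) (a : A) => (χ.1 a : ℂ) :=
      .of_row (hΛ5.trans hA5.symm) (fun χ a => by
        rw [Complex.mul_conj', Circle.norm_coe, Complex.ofReal_one, one_pow]) horth
    refine sum_toCircle_map_eq_zero_of_pow_eq hF (n := 5) (by norm_num) (fun a b => ?_) hsum
    -- The ratio of the terms at `a` and `b` is a cross ratio of the matrix, so their fifth powers
    -- agree.
    have h1 := hH.crossRatio_pow_five hΛ5 hA5 ψ χ a b
    simp only [hval] at h1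
    rw [← Circle.coe_inv_eq_conj, mul_pow, Circle.coe_inv, inv_pow] at h1
    exact (mul_inv_eq_one₀ (pow_ne_zero _ (Circle.coe_ne_zero _))).1 h1
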